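/- Notation: $\mathbb N=\{1,2,\dots\}$, $(\Omega,\mathcal A,\mathbb P)$ is a probability space, and for $q\in[1,\infty)$ the Khintchine constant $B_q\in(0,\infty)$ is the smallest positive number such that $\bigl\|\sum_{j=1}^n r_ja_j\bigr\|_{L^q}\le B_q\bigl(\sum_{j=1}^n a_j^2\bigr)^{1/2}$ for every $n$, all $a_1,\dots,a_n\in\mathbb R$ and every family $(r_j)_{j\in\mathbb N}$ of independent random variables with $\mathbb P(r_j=1)=\mathbb P(r_j=-1)=\tfrac12$. A $\sigma$-finite measure space $(S,\mathcal S,\mu)$ has the approximation-by-averaging property if for every $n\in\mathbb N$ there is a finite or countably infinite family $\{B^n_\kappa:\kappa\in\mathscr K_n\}$ of pairwise disjoint measurable sets of positive, finite measure such that, for every Banach space $E$, every $p\in[1,\infty)$ and every $f\in L^p(S;E)$, the functions $f_n:=\sum_{\kappa\in\mathscr K_n}\mathbf 1_{B^n_\kappa}\,\mu(B^n_\kappa)^{-1}\int_{B^n_\kappa}f\,\mathrm d\mu$ converge to $f$ in $L^p(S;E)$. For a strongly measurable $\eta\colon\Omega\to L^p(S)$ let $\widetilde\eta\colon S\times\Omega\to\mathbb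 R$ be a jointly measurable function with $\eta(\omega)=\widetilde\eta(\cdot,\omega)$ in $L^p(S)$ for $\mathbb P$-almost all $\omega$ (it is unique up to $\mu\otimes\mathbb P$-null sets); $\eta\in L^p(S;L^q(\Omega))$ means that $s\mapsto\widetilde\eta(s,\cdot)$ belongs to this Bochner space, and $\|\eta\|_{L^p(S;L^q(\Omega))}=\bigl(\int_S(\int_\Omega|\widetilde\eta(s,\omega)|^q\,\mathrm d\mathbb P(\omega))^{p/q}\,\mathrm d\mu(s)\bigr)^{1/p}$. Theorem. Let $(S,\mathcal S,\mu)$ be a $\sigma$-finite measure space with the approximation-by-averaging property. Let $p\in[1,\infty)$, $q\in[p,\infty)$, $\widetilde q\in[q,\infty)$, $L\in\mathbb N$, and set $\bar q:=\min\{q,2\}$, $\widehat q:=\min\{\widetilde q,2\}$. Suppose that for every $\ell\in\{1,\dots,L\}$ we have $X_\ell\in L^{\widetilde q}(\Omega;L^p(S))\cap L^p(S;L^{\widetilde q}(\Omega))$, $M_\ell\in\mathbb N$, and that $\xi_{\ell,1},\dots,\xi_{\ell,M_\ell}$ are independent copies, defined on $\Omega$, of the $L^p(S)$-valued random variable $\xi_\ell:=X_\ell-X_{\ell-1}$,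 where $X_0:=0$. Then, for every $U\in L^p(S)$ and all $r\in[\bar q,\widehat q]$, the random variable $U-\sum_{\ell=1}^L\frac1{M_\ell}\sum_{j=1}^{M_\ell}\xi_{\ell,j}$ is in $L^q(\Omega;L^p(S))$, all the norms below are finite, and $$\Bigl\|U-\sum_{\ell=1}^L\frac1{M_\ell}\sum_{j=1}^{M_\ell}\xi_{\ell,j}\Bigr\|_{L^q(\Omega;L^p(S))}\le\|U-\mathbb E[X_L]\|_{L^p(S)}+2B_q\sum_{\ell=1}^L M_\ell^{-(1-\frac1r)}\bigl\|\xi_\ell-\mathbb E[\xi_\ell]\bigr\|_{L^p(S;L^{\max\{q,r\}}(\Omega))}.$$ -/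

import Mathlib

open MeasureTheory ProbabilityTheory Filter Topology
open scoped NNReal ENNReal

universe u v

/-- `(r_j)` is a Rademacher family on `(Ω', P')`: independent `{-1,1}`-valued random variables
taking both values with probability `1/2`. -/
structure IsRademacherFamily {Ω' : Type*} [MeasurableSpace Ω'] (P' : Measure Ω')
    (r : ℕ → Ω' → ℝ) : Prop where
  measurable : ∀ j, Measurable (r j)
  values : ∀ j ω, r j ω = -1 ∨ r j ω = 1
  prob_neg_one : ∀ j, P' {ω | r j ω = -1} = 1 / 2
  prob_one : ∀ j, P' {ω | r j ω = 1} = 1 / 2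
  indep : iIndepFun r P'

/-- `B` is admissible in the upper Khintchine inequality with exponent `q`. (The law of a
Rademacher sum does not depend on the probability space, so spaces in `Type` suffice.) -/
def IsKhintchineUpperBound (q B : ℝ≥0) : Prop :=
  ∀ (Ω' : Type) [MeasurableSpace Ω'] (P' : Measure Ω') [IsProbabilityMeasure P']
    (r : ℕ → Ω' → ℝ), IsRademacherFamily P' r → ∀ (n : ℕ) (a : ℕ → ℝ),
      eLpNorm (fun ω => ∑ j ∈ Finset.range n, r j ω * a j) q P'
        ≤ B * ENNReal.ofReal (√(∑ j ∈ Finset.range n, a j ^ 2))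

/-- The Khintchine constant `B_q`: the smallest positive admissible constant. -/
noncomputable def khintchineB (q : ℝ≥0) : ℝ≥0 :=
  sInf {B : ℝ≥0 | 0 < B ∧ IsKhintchineUpperBound q B}

/-- The function `∑_{k ∈ K} 1_{B_k} (1/μ(B_k)) ∫_{B_k} f dμ`. For pairwise disjoint `B_k` at most
one summand is nonzero at each point. -/
noncomputable def averageOver {S : Type*} [MeasurableSpace S] (μ : Measure S)
    {E : Type*} [NormedAddCommGroup E] [NormedSpace ℝ E]
    (K : Set ℕ) (B : ℕ → Set S) (f : S → E) (s : S) : E :=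
  ∑' k : K, (B k).indicator (fun _ => (μ.real (B k))⁻¹ • ∫ t in B k, f t ∂μ) s

/-- The approximation-by-averaging property of `(S, μ)`: there are families
`{B n k : k ∈ K n}`, finite or countable, of pairwise disjoint measurable sets of positive finite
measure, such that for every Banach space `E`, every `p ∈ [1,∞)` and every `f ∈ L^p(S;E)` the
averages of `f` over the `n`-th family converge to `f` in `L^p(S;E)`. -/
def ApproximationByAveraging {S : Type u} [MeasurableSpace S] (μ : Measure S) : Prop :=
  ∃ (K : ℕ → Set ℕ) (B : ℕ → ℕ → Set S),
    (∀ n, ∀ k ∈ K n, MeasurableSet (B n k) ∧ 0 < μ (B n k) ∧ μ (B n k) < ∞) ∧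
    (∀ n, (K n).PairwiseDisjoint (B n)) ∧
    ∀ (E : Type v) [NormedAddCommGroup E] [NormedSpace ℝ E] [CompleteSpace E]
      (p : ℝ≥0), 1 ≤ p → ∀ f : S → E, MemLp f p μ →
        Tendsto (fun n => eLpNorm (fun s => f s - averageOver μ (K n) (B n) f s) p μ)
          atTop (𝓝 0)

section MixedNorm

variable {S Ω : Type*} [MeasurableSpace S] [MeasurableSpace Ω]

/-- `g` is a jointly measurable version of the `L^p(S)`-valued random variable `η`:
`η(ω) = g(·, ω)` in `L^p(S)` for `P`-almost every `ω`. -/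
def IsJointVersion {p : ℝ≥0∞} {μ : Measure S} (P : Measure Ω) (η : Ω → Lp ℝ p μ)
    (g : S → Ω → ℝ) : Prop :=
  Measurable (Function.uncurry g) ∧ ∀ᵐ ω ∂P, η ω =ᵐ[μ] fun s => g s ω

/-- `η ∈ L^p(S; L^q(Ω))` (Bochner space): for a jointly measurable version `g` of `η`, the map
`s ↦ g(s, ·)` is an element of `L^p(S; L^q(Ω))`. -/
def MemLpLq {p : ℝ≥0∞} {μ : Measure S} (P : Measure Ω) (η : Ω → Lp ℝ p μ) (q : ℝ≥0∞)
    [Fact (1 ≤ q)] : Prop :=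
  ∃ g : S → Ω → ℝ, IsJointVersion P η g ∧
    ∃ G : S → Lp ℝ q P, (∀ᵐ s ∂μ, G s =ᵐ[P] g s) ∧ MemLp G p μ

/-- The norm `(∫_S (∫_Ω |g(s,ω)|^q dP(ω))^{p/q} dμ(s))^{1/p}` of `η` in `L^p(S; L^q(Ω))`, where
`g` is a jointly measurable version of `η`. By `lpLqNorm_eq` the value is the same for all versions,
so that the infimum merely selects it. -/
noncomputable def lpLqNorm {p : ℝ≥0∞} {μ : Measure S} (P : Measure Ω) (η : Ω → Lp ℝ p μ)
    (q : ℝ≥0∞) : ℝ≥0∞ :=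
  ⨅ (g : S → Ω → ℝ) (_ : IsJointVersion P η g), eLpNorm (fun s => eLpNorm (g s) q P) p μ

theorem lpLqNorm_eq {p : ℝ≥0∞} {μ : Measure S} [SigmaFinite μ] {P : Measure Ω} [SigmaFinite P]
    {η : Ω → Lp ℝ p μ} {g : S → Ω → ℝ} (hg : IsJointVersion P η g) (q : ℝ≥0∞) :
    lpLqNorm P η q = eLpNorm (fun s => eLpNorm (g s) q P) p μ := by
  have key : ∀ h : S → Ω → ℝ, IsJointVersion P η h →
      eLpNorm (fun s => eLpNorm (h s) q P) p μ = eLpNorm (fun s => eLpNorm (g s) q P) p μ := by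
    intro h hh
    have h1 : ∀ᵐ ω ∂P, ∀ᵐ s ∂μ, h s ω = g s ω := by
      filter_upwards [hh.2, hg.2] with ω h₁ h₂
      filter_upwards [h₁, h₂] with s a b
      exact a.symm.trans b
    have hm : MeasurableSet {x : S × Ω | h x.1 x.2 = g x.1 x.2} :=
      measurableSet_eq_fun hh.1 hg.1
    have h2 : ∀ᵐ s ∂μ, ∀ᵐ ω ∂P, h s ω = g s ω :=
      (Measure.ae_ae_comm (μ := μ) (ν := P) (p := fun s ω => h s ω = g s ω) hm).mpr h1
    refine eLpNorm_congr_ae ?_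
    filter_upwards [h2] with s hs
    exact eLpNorm_congr_ae hs
  refine le_antisymm (iInf₂_le g hg) (le_iInf₂ fun h hh => (key h hh).ge)

end MixedNorm

/-!
By Minkowski's integral inequality the norm of `L^q(Ω; L^p(S))` is at most the one of
`L^p(S; L^q(Ω))` when `p ≤ q`, so it suffices to treat, for almost every `s`, a sum of `M` centred
i.i.d. real random variables. Splitting the summands according to their sign and conditioning on
one part symmetrizes the sum at the price of a factor `2`; Khintchine's inequality then bounds it
by the square function, and `ℓ^r ⊆ ℓ^2` together with the power mean inequality gives the factor
`M ^ (1 / r)`. Evaluating the copies at a point `s` keeps them i.i.d. because a single jointly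
measurable version of the identity of `L^p(S)`, with respect to the common law of the copies, can
be composed with each of them. The multilevel bound follows by telescoping the expectations.
-/

section Khintchine

theorem abs_pow_le_factorial_mul_exp_add_exp_neg (x : ℝ) (m : ℕ) :
    |x| ^ m ≤ m.factorial * (Real.exp x + Real.exp (-x)) := by
  have h := Real.pow_div_factorial_le_exp |x| (abs_nonneg x) m
  rw [div_le_iff₀' (by positivity)] at h
  exact h.trans (by gcongr; exact Real.exp_abs_le x)

theorem integral_abs_pow_le_of_hasSubgaussianMGF {Ω : Type*} [MeasurableSpace Ω] {P : Measure Ω}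
    {Y : Ω → ℝ} {c : ℝ≥0} (hY : HasSubgaussianMGF Y c P) (m : ℕ) {t : ℝ} (ht : 0 < t) :
    ∫ ω, |Y ω| ^ m ∂P ≤ 2 * m.factorial * Real.exp (c * t ^ 2 / 2) / t ^ m := by
  have hexp : ∀ u, Integrable (fun ω => Real.exp (u * Y ω)) P := hY.integrable_exp_mul
  calc ∫ ω, |Y ω| ^ m ∂P
      ≤ ∫ ω, m.factorial / t ^ m * (Real.exp (t * Y ω) + Real.exp (-t * Y ω)) ∂P := by
        refine integral_mono_of_nonneg (ae_of_all _ fun ω => by positivity)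
          (((hexp t).add (hexp (-t))).const_mul _) (ae_of_all _ fun ω => ?_)
        have h := abs_pow_le_factorial_mul_exp_add_exp_neg (t * Y ω) m
        rw [abs_mul, abs_of_pos ht, mul_pow, ← neg_mul] at h
        change |Y ω| ^ m ≤ m.factorial / t ^ m * _
        rwa [div_mul_eq_mul_div, le_div_iff₀' (by positivity)]
    _ = m.factorial / t ^ m * (mgf Y P t + mgf Y P (-t)) := by
        rw [integral_const_mul, integral_add (hexp t) (hexp (-t))]
        rfl
    _ ≤ m.factorial / t ^ m * (Real.exp (c * t ^ 2 / 2) + Real.exp (c * (-t) ^ 2 / 2)) := by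
        gcongr
        · exact hY.mgf_le t
        · exact hY.mgf_le (-t)
    _ = 2 * m.factorial * Real.exp (c * t ^ 2 / 2) / t ^ m := by
        rw [neg_sq]
        ring

theorem eLpNorm_le_of_hasSubgaussianMGF {Ω : Type*} [MeasurableSpace Ω] {P : Measure Ω}
    {Y : Ω → ℝ} {c : ℝ≥0} (hY : HasSubgaussianMGF Y c P) {m : ℕ} (hm : m ≠ 0) :
    eLpNorm Y m P ≤ ENNReal.ofReal ((2 * m.factorial * Real.exp (1 / 2)) ^ (m : ℝ)⁻¹ * √c) := by
  rcases eq_or_ne c 0 with rfl | hc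
  · simp [eLpNorm_congr_ae hY.ae_eq_zero_of_hasSubgaussianMGF_zero]
  have hc' : (0 : ℝ) < c := by positivity
  have hYm : MemLp Y (m : ℝ≥0∞) P := by exact_mod_cast hY.memLp m
  rw [hYm.eLpNorm_eq_integral_rpow_norm (by exact_mod_cast hm) (by simp)]
  simp only [ENNReal.toReal_natCast, Real.rpow_natCast, Real.norm_eq_abs]
  refine ENNReal.ofReal_le_ofReal
    (Real.rpow_inv_le_iff_of_pos (integral_nonneg fun ω => by positivity) (by positivity)
      (by positivity) |>.2 ?_)
  -- `t = c ^ (-1 / 2)` normalizes the exponent `c * t ^ 2 / 2` to `1 / 2`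
  have h := integral_abs_pow_le_of_hasSubgaussianMGF hY m (t := (√c)⁻¹) (by positivity)
  rwa [inv_pow, Real.sq_sqrt hc'.le, mul_inv_cancel₀ hc'.ne', inv_pow, div_inv_eq_mul,
    ← Real.rpow_inv_natCast_pow (x := 2 * m.factorial * Real.exp (1 / 2)) (by positivity) hm,
    ← mul_pow, ← Real.rpow_natCast] at h

variable {Ω' : Type*} [MeasurableSpace Ω'] {P' : Measure Ω'} [IsProbabilityMeasure P']
  {r : ℕ → Ω' → ℝ}

theorem IsRademacherFamily.integral_eq_zero (hr : IsRademacherFamily P' r) (j : ℕ) :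
    ∫ ω, r j ω ∂P' = 0 := by
  have h₁ : MeasurableSet {ω | r j ω = 1} := hr.measurable j (measurableSet_singleton 1)
  have h₂ : MeasurableSet {ω | r j ω = -1} := hr.measurable j (measurableSet_singleton (-1))
  have hsplit : r j = fun ω => {ω | r j ω = 1}.indicator (fun _ => (1 : ℝ)) ω
      - {ω | r j ω = -1}.indicator (fun _ => (1 : ℝ)) ω := by
    ext ω
    rcases hr.values j ω with h | h <;> simp [Set.indicator, h] <;> norm_num
  rw [hsplit, integral_sub ((integrable_const _).indicator h₁) ((integrable_const _).indicator h₂),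
    integral_indicator_const _ h₁, integral_indicator_const _ h₂]
  simp [Measure.real, hr.prob_one, hr.prob_neg_one]

theorem IsRademacherFamily.hasSubgaussianMGF_one (hr : IsRademacherFamily P' r) (j : ℕ) :
    HasSubgaussianMGF (r j) 1 P' := by
  have h := hasSubgaussianMGF_of_mem_Icc_of_integral_eq_zero (a := -1) (b := 1)
    (hr.measurable j).aemeasurable (ae_of_all _ fun ω => by
      rcases hr.values j ω with h | h <;> simp [h]) (hr.integral_eq_zero j)
  have hvar : ((‖(1 : ℝ) - -1‖₊ / 2) ^ 2 : ℝ≥0) = 1 := by ext; simp; norm_num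
  rwa [hvar] at h

theorem IsRademacherFamily.hasSubgaussianMGF_sum (hr : IsRademacherFamily P' r) (s : Finset ℕ)
    (a : ℕ → ℝ) :
    HasSubgaussianMGF (fun ω => ∑ j ∈ s, r j ω * a j) (∑ j ∈ s, ‖a j‖₊ ^ 2) P' := by
  refine HasSubgaussianMGF.sum_of_iIndepFun
    (hr.indep.comp (fun j x => x * a j) fun j => by fun_prop) fun j _ => ?_
  convert! (hr.hasSubgaussianMGF_one j).const_mul (a j) using 1
  · ext ω
    exact mul_comm _ _
  · ext
    change ‖a j‖ ^ 2 = a j ^ 2 * 1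
    rw [mul_one, Real.norm_eq_abs, sq_abs]

theorem exists_isKhintchineUpperBound (q : ℝ≥0) :
    ∃ B : ℝ≥0, 0 < B ∧ IsKhintchineUpperBound q B := by
  set m : ℕ := ⌈q⌉₊ + 1
  set B : ℝ := (2 * m.factorial * Real.exp (1 / 2)) ^ (m : ℝ)⁻¹
  have hB : 0 < B := by positivity
  have hqm : (q : ℝ≥0∞) ≤ m := by
    exact_mod_cast (Nat.le_ceil q).trans (Nat.cast_le.2 (Nat.le_succ _))
  refine ⟨B.toNNReal, Real.toNNReal_pos.2 hB, fun Ω' _ P' _ r hr n a => ?_⟩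
  have hsub := hr.hasSubgaussianMGF_sum (Finset.range n) a
  calc eLpNorm (fun ω => ∑ j ∈ Finset.range n, r j ω * a j) q P'
      ≤ eLpNorm (fun ω => ∑ j ∈ Finset.range n, r j ω * a j) m P' :=
        eLpNorm_le_eLpNorm_of_exponent_le hqm hsub.aestronglyMeasurable
    _ ≤ ENNReal.ofReal (B * √(∑ j ∈ Finset.range n, ‖a j‖₊ ^ 2 : ℝ≥0)) :=
        eLpNorm_le_of_hasSubgaussianMGF hsub (Nat.succ_ne_zero _)
    _ = B.toNNReal * ENNReal.ofReal (√(∑ j ∈ Finset.range n, a j ^ 2)) := by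
        rw [ENNReal.ofReal_mul hB.le]
        simp [ENNReal.ofReal]

theorem isKhintchineUpperBound_khintchineB (q : ℝ≥0) :
    IsKhintchineUpperBound q (khintchineB q) := by
  intro Ω' _ P' _ r hr n a
  obtain ⟨u, -, hu, hmem⟩ := exists_seq_tendsto_sInf
    (S := {B : ℝ≥0 | 0 < B ∧ IsKhintchineUpperBound q B}) (exists_isKhintchineUpperBound q)
    (OrderBot.bddBelow _)
  exact ge_of_tendsto' (ENNReal.Tendsto.mul_const (ENNReal.tendsto_coe.2 hu)
    (Or.inr ENNReal.ofReal_ne_top)) fun k => (hmem k).2 Ω' P' r hr n a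

theorem exists_isRademacherFamily :
    ∃ (Ω' : Type) (_ : MeasurableSpace Ω') (P' : Measure Ω') (_ : IsProbabilityMeasure P')
      (r : ℕ → Ω' → ℝ), IsRademacherFamily P' r := by
  let ν : Measure Bool := (PMF.uniformOfFintype Bool).toMeasure
  let sign : Bool → ℝ := fun b => if b then 1 else -1
  have hsign : Measurable sign := measurable_of_countable _
  have hprob (j : ℕ) (b : Bool) :
      Measure.infinitePi (fun _ : ℕ => ν) {ω | sign (ω j) = sign b} = 1 / 2 := by
    have hset : {b' | sign b' = sign b} = {b} := by
      ext b'
      cases b <;> cases b' <;> simp [sign] <;> norm_num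
    calc Measure.infinitePi (fun _ : ℕ => ν) {ω | sign (ω j) = sign b}
        = (Measure.infinitePi fun _ : ℕ => ν).map (fun ω => ω j) {b' | sign b' = sign b} :=
          (Measure.map_apply (measurable_pi_apply j) (measurableSet_eq_fun hsign
            measurable_const)).symm
      _ = 1 / 2 := by
          rw [Measure.infinitePi_map_eval, hset,
            PMF.toMeasure_apply_singleton _ _ (measurableSet_singleton _)]
          simp
  exact ⟨ℕ → Bool, inferInstance, Measure.infinitePi fun _ => ν, inferInstance,
    fun j ω => sign (ω j),
    { measurable := fun j => hsign.comp (measurable_pi_apply j)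
      values := fun j ω => by cases ω j <;> simp [sign]
      prob_neg_one := fun j => hprob j false
      prob_one := fun j => hprob j true
      indep := iIndepFun_infinitePi fun _ => hsign }⟩

theorem eLpNorm_sum_isRademacherFamily_mul_le {Ω' : Type} [MeasurableSpace Ω'] {P' : Measure Ω'}
    [IsProbabilityMeasure P'] {r : ℕ → Ω' → ℝ} (hr : IsRademacherFamily P' r) (q : ℝ≥0) {n : ℕ}
    (a : Fin n → ℝ) :
    eLpNorm (fun ω => ∑ i : Fin n, r i ω * a i) q P' ≤ khintchineB q * ‖√(∑ i, a i ^ 2)‖ₑ := by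
  have h := isKhintchineUpperBound_khintchineB q Ω' P' r hr n
    fun j => if hj : j < n then a ⟨j, hj⟩ else 0
  simp only [Finset.sum_range, Fin.is_lt, dif_pos, Fin.eta] at h
  rwa [Real.enorm_of_nonneg (Real.sqrt_nonneg _)]

end Khintchine

section Symmetrization

variable {Ω E : Type*} [MeasurableSpace Ω] {P : Measure Ω} [IsProbabilityMeasure P]
  [NormedAddCommGroup E] [NormedSpace ℝ E] [CompleteSpace E] [SecondCountableTopology E]
  [MeasurableSpace E] [BorelSpace E] {q : ℝ≥0∞}

theorem eLpNorm_le_eLpNorm_add_of_indepFun {V W : Ω → E} (hV : Measurable V) (hW : Measurable W)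
    (hVW : IndepFun V W P) (hVint : Integrable V P) (hWint : Integrable W P)
    (hWmean : ∫ ω, W ω ∂P = 0) (hq : 1 ≤ q) : eLpNorm V q P ≤ eLpNorm (V + W) q P := by
  have hcond : P[V + W | MeasurableSpace.comap V inferInstance] =ᵐ[P] V := by
    filter_upwards [condExp_add hVint hWint (MeasurableSpace.comap V inferInstance),
      condExp_indep_eq hW.comap_le hV.comap_le (comap_measurable W).stronglyMeasurable
        ((IndepFun_iff_Indep _ _ _).1 hVW.symm)] with ω hadd hindep
    rw [hadd, Pi.add_apply, hindep, hWmean, add_zero,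
      condExp_of_stronglyMeasurable hV.comap_le (comap_measurable V).stronglyMeasurable hVint]
  calc eLpNorm V q P = eLpNorm (P[V + W | MeasurableSpace.comap V inferInstance]) q P :=
        eLpNorm_congr_ae hcond.symm
    _ ≤ eLpNorm (V + W) q P := eLpNorm_condExp_le_eLpNorm _ hq

theorem eLpNorm_add_le_two_mul_eLpNorm_sub_of_indepFun {V W : Ω → E} (hV : Measurable V)
    (hW : Measurable W) (hVW : IndepFun V W P) (hVint : Integrable V P) (hWint : Integrable W P)
    (hVmean : ∫ ω, V ω ∂P = 0) (hWmean : ∫ ω, W ω ∂P = 0) (hq : 1 ≤ q) :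
    eLpNorm (V + W) q P ≤ 2 * eLpNorm (V - W) q P := by
  have hVW' : IndepFun V (-W) P := hVW.comp measurable_id measurable_neg
  have hWmean' : ∫ ω, (-W) ω ∂P = 0 := by simp only [Pi.neg_apply, integral_neg, hWmean, neg_zero]
  have hVle : eLpNorm V q P ≤ eLpNorm (V - W) q P := by
    rw [sub_eq_add_neg]
    exact eLpNorm_le_eLpNorm_add_of_indepFun hV hW.neg hVW' hVint hWint.neg hWmean' hq
  have hWle : eLpNorm W q P ≤ eLpNorm (V - W) q P := by
    rw [sub_eq_neg_add, ← eLpNorm_neg W]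
    exact eLpNorm_le_eLpNorm_add_of_indepFun hW.neg hV hVW'.symm hWint.neg hVint hVmean hq
  calc eLpNorm (V + W) q P ≤ eLpNorm V q P + eLpNorm W q P :=
        eLpNorm_add_le hV.aestronglyMeasurable hW.aestronglyMeasurable hq
    _ ≤ 2 * eLpNorm (V - W) q P := by
        rw [two_mul]
        exact add_le_add hVle hWle

theorem eLpNorm_sum_le_two_mul_eLpNorm_sum_smul_of_sign {ι : Type*} [Fintype ι] {y : ι → Ω → E}
    (hy : ∀ i, Measurable (y i)) (hindep : iIndepFun y P) (hyint : ∀ i, Integrable (y i) P)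
    (hmean : ∀ i, ∫ ω, y i ω ∂P = 0) (hq : 1 ≤ q) {ε : ι → ℝ} (hε : ∀ i, ε i = -1 ∨ ε i = 1) :
    eLpNorm (fun ω => ∑ i, y i ω) q P ≤ 2 * eLpNorm (fun ω => ∑ i, ε i • y i ω) q P := by
  classical
  let partialSum (J : Finset ι) (ω : Ω) : E := ∑ i ∈ J, y i ω
  have hmeas (J : Finset ι) : Measurable (partialSum J) :=
    Finset.measurable_fun_sum _ fun i _ => hy i
  have hpint (J : Finset ι) : Integrable (partialSum J) P :=
    integrable_finsetSum _ fun i _ => hyint i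
  have hpmean (J : Finset ι) : ∫ ω, partialSum J ω ∂P = 0 := by
    rw [integral_finsetSum _ fun i _ => hyint i]
    exact Finset.sum_eq_zero fun i _ => hmean i
  let J : Finset ι := {i | ε i = 1}
  have hJ : IndepFun (partialSum J) (partialSum Jᶜ) P := by
    have h := (hindep.indepFun_finset J Jᶜ disjoint_compl_right hy).comp
      (φ := fun x : J → E => ∑ i, x i) (ψ := fun x : (Jᶜ : Finset ι) → E => ∑ i, x i)
      (by fun_prop) (by fun_prop)
    convert h using 1 <;> ext ω <;> exact (Finset.sum_coe_sort _ fun i => y i ω).symm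
  have hsum : (fun ω => ∑ i, y i ω) = partialSum J + partialSum Jᶜ := by
    ext ω
    exact (Finset.sum_add_sum_compl J fun i => y i ω).symm
  have hsign : (fun ω => ∑ i, ε i • y i ω) = partialSum J - partialSum Jᶜ := by
    ext ω
    rw [← Finset.sum_add_sum_compl J fun i => ε i • y i ω, sub_eq_add_neg]
    simp only [Pi.add_apply, Pi.neg_apply, partialSum, ← Finset.sum_neg_distrib]
    congr 1 <;> refine Finset.sum_congr rfl fun i hi => ?_
    · rw [(Finset.mem_filter.1 hi).2, one_smul]
    · rw [(hε i).resolve_right (by simpa [J] using hi), neg_one_smul]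
  rw [hsum, hsign]
  exact eLpNorm_add_le_two_mul_eLpNorm_sub_of_indepFun (hmeas _) (hmeas _) hJ (hpint _) (hpint _)
    (hpmean _) (hpmean _) hq

end Symmetrization

section SquareFunction

variable {Ω : Type*} [MeasurableSpace Ω] {P : Measure Ω}

theorem eLpNorm_sum_le_khintchineB_mul_eLpNorm_sqrt_sum_sq [IsProbabilityMeasure P] {M : ℕ}
    {y : Fin M → Ω → ℝ} (hy : ∀ i, Measurable (y i)) (hindep : iIndepFun y P)
    (hyint : ∀ i, Integrable (y i) P) (hmean : ∀ i, ∫ ω, y i ω ∂P = 0) {q : ℝ≥0} (hq : 1 ≤ q) :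
    eLpNorm (fun ω => ∑ i, y i ω) q P
      ≤ 2 * khintchineB q * eLpNorm (fun ω => √(∑ i, y i ω ^ 2)) q P := by
  have hq0 : q ≠ 0 := (zero_lt_one.trans_le hq).ne'
  have hq0' : (0 : ℝ) < q := by positivity
  obtain ⟨Ω', _, P', _, r, hr⟩ := exists_isRademacherFamily
  have hm : Measurable fun z : Ω' × Ω => ‖∑ i : Fin M, r i z.1 * y i z.2‖ₑ ^ (q : ℝ) := by
    have := hr.measurable
    fun_prop
  have hsymm (ω' : Ω') : ∫⁻ ω, ‖∑ i, y i ω‖ₑ ^ (q : ℝ) ∂P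
      ≤ 2 ^ (q : ℝ) * ∫⁻ ω, ‖∑ i : Fin M, r i ω' * y i ω‖ₑ ^ (q : ℝ) ∂P := by
    rw [← eLpNorm_nnreal_pow_eq_lintegral hq0, ← eLpNorm_nnreal_pow_eq_lintegral hq0,
      ← ENNReal.mul_rpow_of_nonneg _ _ hq0'.le]
    gcongr
    exact eLpNorm_sum_le_two_mul_eLpNorm_sum_smul_of_sign hy hindep hyint hmean
      (by exact_mod_cast hq) fun i => hr.values i ω'
  have hkhin (ω : Ω) : ∫⁻ ω', ‖∑ i : Fin M, r i ω' * y i ω‖ₑ ^ (q : ℝ) ∂P'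
      ≤ (khintchineB q : ℝ≥0∞) ^ (q : ℝ) * ‖√(∑ i, y i ω ^ 2)‖ₑ ^ (q : ℝ) := by
    rw [← eLpNorm_nnreal_pow_eq_lintegral hq0, ← ENNReal.mul_rpow_of_nonneg _ _ hq0'.le]
    gcongr
    exact eLpNorm_sum_isRademacherFamily_mul_le hr q fun i => y i ω
  rw [← ENNReal.rpow_le_rpow_iff hq0', ENNReal.mul_rpow_of_nonneg _ _ hq0'.le,
    ENNReal.mul_rpow_of_nonneg _ _ hq0'.le, eLpNorm_nnreal_pow_eq_lintegral hq0,
    eLpNorm_nnreal_pow_eq_lintegral hq0]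
  calc ∫⁻ ω, ‖∑ i, y i ω‖ₑ ^ (q : ℝ) ∂P
      = ∫⁻ _, (∫⁻ ω, ‖∑ i, y i ω‖ₑ ^ (q : ℝ) ∂P) ∂P' := by simp
    _ ≤ ∫⁻ ω', (2 ^ (q : ℝ) * ∫⁻ ω, ‖∑ i : Fin M, r i ω' * y i ω‖ₑ ^ (q : ℝ) ∂P) ∂P' :=
        lintegral_mono hsymm
    _ = 2 ^ (q : ℝ) * ∫⁻ ω, ∫⁻ ω', ‖∑ i : Fin M, r i ω' * y i ω‖ₑ ^ (q : ℝ) ∂P' ∂P := by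
        rw [lintegral_const_mul _ hm.lintegral_prod_right',
          lintegral_lintegral_swap hm.aemeasurable]
    _ ≤ 2 ^ (q : ℝ) * ∫⁻ ω, ((khintchineB q : ℝ≥0∞) ^ (q : ℝ) *
          ‖√(∑ i, y i ω ^ 2)‖ₑ ^ (q : ℝ)) ∂P := by
        gcongr with ω
        exact hkhin ω
    _ = 2 ^ (q : ℝ) * khintchineB q ^ (q : ℝ) * ∫⁻ ω, ‖√(∑ i, y i ω ^ 2)‖ₑ ^ (q : ℝ) ∂P := by
        rw [lintegral_const_mul _ (by fun_prop), mul_assoc]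

theorem sum_rpow_le_rpow_sum {ι : Type*} (s : Finset ι) (f : ι → ℝ≥0∞) {p : ℝ} (hp : 1 ≤ p) :
    ∑ i ∈ s, f i ^ p ≤ (∑ i ∈ s, f i) ^ p := by
  classical
  induction s using Finset.induction_on with
  | empty => simp
  | insert i s hi ih =>
    rw [Finset.sum_insert hi, Finset.sum_insert hi]
    exact (add_le_add le_rfl ih).trans (ENNReal.add_rpow_le_rpow_add _ _ hp)

theorem enorm_sqrt_sum_sq_le {ι : Type*} (s : Finset ι) (a : ι → ℝ) {r : ℝ} (hr : 0 < r)
    (hr2 : r ≤ 2) : ‖√(∑ i ∈ s, a i ^ 2)‖ₑ ≤ (∑ i ∈ s, ‖a i‖ₑ ^ r) ^ (1 / r) := by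
  have hsq (i : ι) : ENNReal.ofReal (a i ^ 2) = (‖a i‖ₑ ^ r) ^ (2 / r) := by
    rw [← ENNReal.rpow_mul, mul_div_cancel₀ _ hr.ne', ENNReal.rpow_ofNat, ← sq_abs,
      ENNReal.ofReal_pow (abs_nonneg _), ← Real.norm_eq_abs, ofReal_norm]
  calc ‖√(∑ i ∈ s, a i ^ 2)‖ₑ = (∑ i ∈ s, (‖a i‖ₑ ^ r) ^ (2 / r)) ^ (1 / 2 : ℝ) := by
        rw [Real.enorm_of_nonneg (Real.sqrt_nonneg _), Real.sqrt_eq_rpow,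
          ← ENNReal.ofReal_rpow_of_nonneg (Finset.sum_nonneg fun i _ => sq_nonneg _) (by norm_num),
          ENNReal.ofReal_sum_of_nonneg fun i _ => sq_nonneg _]
        simp only [hsq]
    _ ≤ ((∑ i ∈ s, ‖a i‖ₑ ^ r) ^ (2 / r)) ^ (1 / 2 : ℝ) := by
        gcongr
        exact sum_rpow_le_rpow_sum _ _ ((one_le_div hr).2 hr2)
    _ = (∑ i ∈ s, ‖a i‖ₑ ^ r) ^ (1 / r) := by
        rw [← ENNReal.rpow_mul]
        congr 1
        field_simp

theorem enorm_sqrt_sum_sq_rpow_le {ι : Type*} (s : Finset ι) (a : ι → ℝ) {r t : ℝ} (hr : 0 < r)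
    (hr2 : r ≤ 2) (hrt : r ≤ t) :
    ‖√(∑ i ∈ s, a i ^ 2)‖ₑ ^ t ≤ (s.card : ℝ≥0∞) ^ (t / r - 1) * ∑ i ∈ s, ‖a i‖ₑ ^ t := by
  have ht : 0 ≤ t := hr.le.trans hrt
  calc ‖√(∑ i ∈ s, a i ^ 2)‖ₑ ^ t
      ≤ ((∑ i ∈ s, ‖a i‖ₑ ^ r) ^ (1 / r)) ^ t := by
        gcongr
        exact enorm_sqrt_sum_sq_le s a hr hr2
    _ = (∑ i ∈ s, ‖a i‖ₑ ^ r) ^ (t / r) := by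
        rw [← ENNReal.rpow_mul]
        ring_nf
    _ ≤ (s.card : ℝ≥0∞) ^ (t / r - 1) * ∑ i ∈ s, (‖a i‖ₑ ^ r) ^ (t / r) :=
        ENNReal.rpow_sum_le_const_mul_sum_rpow _ _ ((one_le_div hr).2 hrt)
    _ = (s.card : ℝ≥0∞) ^ (t / r - 1) * ∑ i ∈ s, ‖a i‖ₑ ^ t := by
        simp only [← ENNReal.rpow_mul, mul_div_cancel₀ _ hr.ne']

theorem eLpNorm_sqrt_sum_sq_le_of_identDistrib {ι : Type*} (s : Finset ι) {y : ι → Ω → ℝ}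
    {z : Ω → ℝ} (hyz : ∀ i ∈ s, IdentDistrib (y i) z P P) {r t : ℝ≥0} (hr : 0 < r) (hr2 : r ≤ 2)
    (hrt : r ≤ t) :
    eLpNorm (fun ω => √(∑ i ∈ s, y i ω ^ 2)) t P
      ≤ (s.card : ℝ≥0∞) ^ (1 / (r : ℝ)) * eLpNorm z t P := by
  rcases s.eq_empty_or_nonempty with rfl | hs
  · simp
  have hr0 : (0 : ℝ) < r := hr
  have ht0 : t ≠ 0 := (hr.trans_le hrt).ne'
  have ht0' : (0 : ℝ) < t := by positivity
  rw [← ENNReal.rpow_le_rpow_iff ht0', ENNReal.mul_rpow_of_nonneg _ _ ht0'.le,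
    eLpNorm_nnreal_pow_eq_lintegral ht0, eLpNorm_nnreal_pow_eq_lintegral ht0]
  have hmeas (i : ι) (hi : i ∈ s) : AEMeasurable (fun ω => ‖y i ω‖ₑ ^ (t : ℝ)) P :=
    (hyz i hi).aemeasurable_fst.enorm.pow_const _
  calc ∫⁻ ω, ‖√(∑ i ∈ s, y i ω ^ 2)‖ₑ ^ (t : ℝ) ∂P
      ≤ ∫⁻ ω, (s.card : ℝ≥0∞) ^ ((t : ℝ) / r - 1) * ∑ i ∈ s, ‖y i ω‖ₑ ^ (t : ℝ) ∂P :=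
        lintegral_mono fun ω => enorm_sqrt_sum_sq_rpow_le s _ hr0 hr2 hrt
    _ = (s.card : ℝ≥0∞) ^ ((t : ℝ) / r - 1) * ∑ i ∈ s, ∫⁻ ω, ‖y i ω‖ₑ ^ (t : ℝ) ∂P := by
        rw [lintegral_const_mul'' _ (Finset.aemeasurable_fun_sum _ hmeas),
          lintegral_finsetSum' _ hmeas]
    _ = (s.card : ℝ≥0∞) ^ ((t : ℝ) / r - 1) * (s.card * ∫⁻ ω, ‖z ω‖ₑ ^ (t : ℝ) ∂P) := by
        have hyi (i : ι) (hi : i ∈ s) : ∫⁻ ω, ‖y i ω‖ₑ ^ (t : ℝ) ∂P = ∫⁻ ω, ‖z ω‖ₑ ^ (t : ℝ) ∂P :=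
          ((hyz i hi).comp (u := fun x : ℝ => ‖x‖ₑ ^ (t : ℝ)) (by fun_prop)).lintegral_eq
        rw [Finset.sum_congr rfl hyi, Finset.sum_const, nsmul_eq_mul]
    _ = ((s.card : ℝ≥0∞) ^ (1 / (r : ℝ))) ^ (t : ℝ) * ∫⁻ ω, ‖z ω‖ₑ ^ (t : ℝ) ∂P := by
        have hcard : (s.card : ℝ≥0∞) ≠ 0 := by simpa using hs.ne_empty
        have hexp : 1 / (r : ℝ) * t = t / r - 1 + 1 := by ring
        rw [← ENNReal.rpow_mul, hexp, ENNReal.rpow_add _ _ hcard (by simp), ENNReal.rpow_one,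
          mul_assoc]

theorem eLpNorm_sum_le_khintchineB_mul_of_identDistrib [IsProbabilityMeasure P] {M : ℕ}
    {y : Fin M → Ω → ℝ} {z : Ω → ℝ} (hy : ∀ i, Measurable (y i)) (hindep : iIndepFun y P)
    (hyz : ∀ i, IdentDistrib (y i) z P P) (hzint : Integrable z P) (hmean : ∫ ω, z ω ∂P = 0)
    {q r : ℝ≥0} (hq : 1 ≤ q) (hr : 0 < r) (hr2 : r ≤ 2) :
    eLpNorm (fun ω => ∑ i, y i ω) q P
      ≤ 2 * khintchineB q * (M ^ (1 / (r : ℝ)) * eLpNorm z (max q r : ℝ≥0) P) := by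
  calc eLpNorm (fun ω => ∑ i, y i ω) q P
      ≤ 2 * khintchineB q * eLpNorm (fun ω => √(∑ i, y i ω ^ 2)) q P :=
        eLpNorm_sum_le_khintchineB_mul_eLpNorm_sqrt_sum_sq hy hindep
          (fun i => (hyz i).integrable_iff.2 hzint) (fun i => (hyz i).integral_eq.trans hmean) hq
    _ ≤ 2 * khintchineB q * eLpNorm (fun ω => √(∑ i, y i ω ^ 2)) (max q r : ℝ≥0) P := by
        gcongr
        exact eLpNorm_le_eLpNorm_of_exponent_le (by exact_mod_cast le_max_left q r) (by fun_prop)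
    _ ≤ 2 * khintchineB q * (M ^ (1 / (r : ℝ)) * eLpNorm z (max q r : ℝ≥0) P) := by
        gcongr
        simpa using eLpNorm_sqrt_sum_sq_le_of_identDistrib Finset.univ (fun i _ => hyz i) hr hr2
          (le_max_right q r)

end SquareFunction

section JointVersion

variable {S Ω : Type*} [MeasurableSpace S] [MeasurableSpace Ω] {μ : Measure S} {P : Measure Ω}
  {p : ℝ≥0∞}

theorem ae_tendsto_coeFn_of_norm_sub_lt_two_inv_pow {E : Type*} [NormedAddCommGroup E]
    [CompleteSpace E] [hp : Fact (1 ≤ p)] {u : ℕ → Lp E p μ} {x : Lp E p μ}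
    (h : ∀ n, ‖u n - x‖ < 2⁻¹ ^ n) : ∀ᵐ s ∂μ, Tendsto (fun n => u n s) atTop (𝓝 (x s)) := by
  have hlt (N n : ℕ) (hn : N ≤ n) : ‖u n - x‖ₑ < 2⁻¹ ^ N := by
    rw [← ofReal_norm, ENNReal.ofReal_lt_iff_lt_toReal (norm_nonneg _)
      (ENNReal.pow_ne_top (by simp))]
    simpa using (h n).trans_le (pow_le_pow_of_le_one (by norm_num) (by norm_num) hn)
  have hexists : ∀ᵐ s ∂μ, ∃ l : E, Tendsto (fun n => u n s) atTop (𝓝 l) := by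
    refine Lp.ae_tendsto_of_cauchy_eLpNorm (p := p) (B := fun N => 2⁻¹ ^ N + 2⁻¹ ^ N)
      (fun n => Lp.aestronglyMeasurable (u n)) hp.out ?_ fun N n m hn hm => ?_
    · rw [ENNReal.tsum_add, ENNReal.tsum_geometric]
      simp [ENNReal.one_sub_inv_two]
    · rw [← eLpNorm_congr_ae (Lp.coeFn_sub (u n) (u m)), ← Lp.enorm_def,
        ← sub_sub_sub_cancel_right (u n) (u m) x]
      exact enorm_sub_le.trans_lt (ENNReal.add_lt_add (hlt N n hn) (hlt N m hm))
  have hLp : Tendsto u atTop (𝓝 x) := by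
    rw [tendsto_iff_norm_sub_tendsto_zero]
    exact squeeze_zero (fun n => norm_nonneg _) (fun n => (h n).le)
      (tendsto_pow_atTop_nhds_zero_of_lt_one (by norm_num) (by norm_num))
  obtain ⟨ns, hns, hsub⟩ := (tendstoInMeasure_of_tendsto_Lp hLp).exists_seq_tendsto_ae
  filter_upwards [hexists, hsub] with s ⟨l, hl⟩ hs
  rwa [tendsto_nhds_unique hs (hl.comp hns.tendsto_atTop)]

theorem exists_isJointVersion [Fact (1 ≤ p)] {η : Ω → Lp ℝ p μ}
    (hη : AEStronglyMeasurable η P) : ∃ g : S → Ω → ℝ, IsJointVersion P η g := by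
  classical
  obtain ⟨η', hη', hae⟩ := hη
  obtain ⟨c, hc, hsub⟩ := hη'.isSeparable_range
  obtain ⟨d, hd⟩ := (hc.insert 0).exists_eq_range (Set.insert_nonempty _ _)
  have happrox (n : ℕ) (z : S × Ω) : ∃ k, ‖d k - η' z.2‖ < 2⁻¹ ^ n := by
    have hmem : η' z.2 ∈ closure (Set.range d) :=
      hd ▸ closure_mono (Set.subset_insert _ _) (hsub (Set.mem_range_self z.2))
    obtain ⟨-, ⟨k, rfl⟩, hk⟩ := Metric.mem_closure_iff.1 hmem (2⁻¹ ^ n) (by positivity)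
    exact ⟨k, by rwa [dist_comm, dist_eq_norm] at hk⟩
  -- Choosing the least index keeps the choice measurable; the geometric rate makes the
  -- approximations converge `μ`-a.e. without passing to an `ω`-dependent subsequence.
  let G (n : ℕ) (z : S × Ω) : ℝ := d (Nat.find (happrox n z)) z.1
  have hG (n : ℕ) : Measurable (G n) := by
    refine Measurable.find (f := fun k (z : S × Ω) => d k z.1)
      (fun k => (Lp.stronglyMeasurable (d k)).measurable.comp measurable_fst) (fun k => ?_)
      (happrox n)
    exact measurableSet_lt ((stronglyMeasurable_const.sub hη').norm.measurable.comp measurable_snd)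
      measurable_const
  refine ⟨fun s ω => limsup (fun n => G n (s, ω)) atTop, Measurable.limsup hG, ?_⟩
  filter_upwards [hae] with ω hω
  rw [hω]
  rcases isEmpty_or_nonempty S with hS | ⟨⟨s₀⟩⟩
  · exact ae_of_all _ fun s => isEmptyElim s
  filter_upwards [ae_tendsto_coeFn_of_norm_sub_lt_two_inv_pow
    (u := fun n => d (Nat.find (happrox n (s₀, ω)))) fun n => Nat.find_spec (happrox n (s₀, ω))]
    with s hs
  exact hs.limsup_eq.symm

theorem isJointVersion_const (f : Lp ℝ p μ) : IsJointVersion P (fun _ => f) (fun s _ => f s) :=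
  ⟨(Lp.stronglyMeasurable f).measurable.comp measurable_fst, ae_of_all _ fun _ => .rfl⟩

theorem IsJointVersion.sub {η₁ η₂ : Ω → Lp ℝ p μ} {g₁ g₂ : S → Ω → ℝ}
    (h₁ : IsJointVersion P η₁ g₁) (h₂ : IsJointVersion P η₂ g₂) :
    IsJointVersion P (η₁ - η₂) (fun s => g₁ s - g₂ s) := by
  refine ⟨h₁.1.sub h₂.1, ?_⟩
  filter_upwards [h₁.2, h₂.2] with ω h1 h2
  filter_upwards [Lp.coeFn_sub (η₁ ω) (η₂ ω), h1, h2] with s hs hs1 hs2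
  simp only [Pi.sub_apply] at hs ⊢
  rw [hs, hs1, hs2]

theorem IsJointVersion.fun_sum {ι : Type*} (t : Finset ι) {η : ι → Ω → Lp ℝ p μ}
    {g : ι → S → Ω → ℝ} (hg : ∀ i ∈ t, IsJointVersion P (η i) (g i)) :
    IsJointVersion P (fun ω => ∑ i ∈ t, η i ω) (fun s ω => ∑ i ∈ t, g i s ω) := by
  refine ⟨Finset.measurable_fun_sum _ fun i hi => (hg i hi).1, ?_⟩
  filter_upwards [(Finset.eventually_all t).2 fun i hi => (hg i hi).2] with ω hω
  filter_upwards [Lp.coeFn_fun_finsetSum t fun i => η i ω, (Finset.eventually_all t).2 hω]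
    with s hsum hs
  rw [hsum]
  exact Finset.sum_congr rfl hs

theorem IsJointVersion.comp_of_map_eq [MeasurableSpace (Lp ℝ p μ)] {ν : Measure (Lp ℝ p μ)}
    {e : S → Lp ℝ p μ → ℝ} (he : IsJointVersion ν id e) {η η' : Ω → Lp ℝ p μ}
    (hη' : Measurable η') (hae : η =ᵐ[P] η') (hmap : P.map η = ν) :
    IsJointVersion P η (fun s ω => e s (η' ω)) := by
  refine ⟨he.1.comp (measurable_fst.prodMk (hη'.comp measurable_snd)), ?_⟩
  rw [Measure.map_congr hae] at hmap
  subst hmap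
  filter_upwards [ae_of_ae_map hη'.aemeasurable he.2, hae] with ω h1 h2
  rw [h2]
  exact h1

theorem IsJointVersion.eLpNorm_eq {η : Ω → Lp ℝ p μ} {g : S → Ω → ℝ}
    (hg : IsJointVersion P η g) (q : ℝ≥0∞) :
    eLpNorm η q P = eLpNorm (fun ω => eLpNorm (fun s => g s ω) p μ) q P := by
  refine eLpNorm_congr_enorm_ae ?_
  filter_upwards [hg.2] with ω hω
  rw [Lp.enorm_def, enorm_eq_self, eLpNorm_congr_ae hω]

end JointVersion

section Integral

variable {S Ω : Type*} [MeasurableSpace S] [MeasurableSpace Ω] {μ : Measure S} {P : Measure Ω}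
  {p : ℝ≥0∞}

theorem lintegral_restrict_enorm_le_mul_rpow {E : Type*} [NormedAddCommGroup E] (hp : 1 ≤ p)
    (A : Set S) {f : S → E} (hf : AEStronglyMeasurable f μ) :
    ∫⁻ s in A, ‖f s‖ₑ ∂μ ≤ eLpNorm f p μ * μ A ^ (1 - 1 / p.toReal) := by
  rw [← eLpNorm_one_eq_lintegral_enorm]
  refine (eLpNorm_le_eLpNorm_mul_rpow_measure_univ hp hf.restrict).trans ?_
  rw [Measure.restrict_apply_univ, ENNReal.toReal_one, div_one]
  gcongr
  exact Measure.restrict_le_self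

theorem exists_continuousLinearMap_eq_setIntegral [Fact (1 ≤ p)] {A : Set S}
    (hAm : MeasurableSet A) (hA : μ A ≠ ∞) :
    ∃ T : Lp ℝ p μ →L[ℝ] ℝ, ∀ f : Lp ℝ p μ, T f = ∫ s in A, f s ∂μ := by
  have : Fact (1 ≤ p.conjExponent) := ⟨le_self_add⟩
  refine ⟨(ContinuousLinearMap.lpPairing μ p p.conjExponent (.mul ℝ ℝ)).flip
    (indicatorConstLp _ hAm hA 1), fun f => ?_⟩
  rw [ContinuousLinearMap.flip_apply, ContinuousLinearMap.lpPairing_eq_integral,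
    ← integral_indicator hAm]
  refine integral_congr_ae ?_
  filter_upwards [indicatorConstLp_coeFn (p := p.conjExponent) (hs := hAm) (hμs := hA)
    (c := (1 : ℝ))] with s hs
  rw [hs, ContinuousLinearMap.mul_apply', ← Set.indicator_mul_right]
  simp

theorem IsJointVersion.integrable_uncurry_restrict [SFinite μ] [SFinite P] [hp : Fact (1 ≤ p)]
    {η : Ω → Lp ℝ p μ} {g : S → Ω → ℝ} (hg : IsJointVersion P η g) (hη : Integrable η P)
    {A : Set S} (hA : μ A ≠ ∞) : Integrable (Function.uncurry g) ((μ.restrict A).prod P) := by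
  have hexp : 0 ≤ 1 - 1 / p.toReal := by
    rcases eq_or_ne p ∞ with rfl | hp_top
    · simp
    · have : 1 ≤ p.toReal := (ENNReal.toReal_mono hp_top hp.out).trans_eq' (by simp)
      exact sub_nonneg.2 ((div_le_one (zero_lt_one.trans_le this)).2 this)
  have hAfin : μ A ^ (1 - 1 / p.toReal) ≠ ∞ := ENNReal.rpow_ne_top_of_nonneg hexp hA
  refine ⟨hg.1.aestronglyMeasurable, ?_⟩
  rw [HasFiniteIntegral, lintegral_prod_symm _ hg.1.enorm.aemeasurable]
  calc ∫⁻ ω, ∫⁻ s in A, ‖g s ω‖ₑ ∂μ ∂P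
      ≤ ∫⁻ ω, ‖η ω‖ₑ * μ A ^ (1 - 1 / p.toReal) ∂P := by
        refine lintegral_mono_ae ?_
        filter_upwards [hg.2] with ω hω
        rw [Lp.enorm_def, eLpNorm_congr_ae hω]
        exact lintegral_restrict_enorm_le_mul_rpow hp.out A
          (hg.1.comp measurable_prodMk_right).aestronglyMeasurable
    _ = (∫⁻ ω, ‖η ω‖ₑ ∂P) * μ A ^ (1 - 1 / p.toReal) := lintegral_mul_const' _ _ hAfin
    _ < ∞ := ENNReal.mul_lt_top hη.2 hAfin.lt_top

theorem IsJointVersion.ae_integrable [SigmaFinite μ] [SFinite P] [Fact (1 ≤ p)]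
    {η : Ω → Lp ℝ p μ} {g : S → Ω → ℝ} (hg : IsJointVersion P η g) (hη : Integrable η P) :
    ∀ᵐ s ∂μ, Integrable (g s) P :=
  ae_of_forall_measure_lt_top_ae_restrict _ fun _ _ hA =>
    (hg.integrable_uncurry_restrict hη hA.ne).prod_right_ae

theorem IsJointVersion.integral_ae_eq_coeFn_integral [SigmaFinite μ] [SFinite P] [Fact (1 ≤ p)]
    {η : Ω → Lp ℝ p μ} {g : S → Ω → ℝ} (hg : IsJointVersion P η g) (hη : Integrable η P) :
    (fun s => ∫ ω, g s ω ∂P) =ᵐ[μ] (∫ ω, η ω ∂P : Lp ℝ p μ) := by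
  refine ae_eq_of_forall_setIntegral_eq_of_sigmaFinite
    (fun A _ hA => (hg.integrable_uncurry_restrict hη hA.ne).integral_prod_left)
    (fun A _ hA => integrableOn_Lp_of_measure_ne_top _ Fact.out hA.ne) fun A hAm hA => ?_
  obtain ⟨T, hT⟩ := exists_continuousLinearMap_eq_setIntegral (μ := μ) (p := p) hAm hA.ne
  rw [integral_integral_swap (hg.integrable_uncurry_restrict hη hA.ne), ← hT,
    ← T.integral_comp_comm hη]
  refine integral_congr_ae ?_
  filter_upwards [hg.2] with ω hω
  rw [hT]
  exact (integral_congr_ae (ae_restrict_of_ae hω)).symm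

end Integral

section Minkowski

variable {S Ω : Type*} [MeasurableSpace S] [MeasurableSpace Ω] {μ : Measure S} {P : Measure Ω}

theorem rpow_one_div_le_of_le_mul_rpow {I C : ℝ≥0∞} {t t' : ℝ} (htt' : t.HolderConjugate t')
    (hI : I ≠ ∞) (h : I ≤ C * I ^ (1 / t')) : I ^ (1 / t) ≤ C := by
  rcases eq_or_ne I 0 with rfl | hI0
  · rw [ENNReal.zero_rpow_of_pos (one_div_pos.2 htt'.pos)]
    exact zero_le
  have hsplit : I = I ^ (1 / t) * I ^ (1 / t') := by
    rw [← ENNReal.rpow_add _ _ hI0 hI, one_div, one_div, htt'.inv_add_inv_eq_one, ENNReal.rpow_one]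
  refine (ENNReal.mul_le_mul_iff_left (c := I ^ (1 / t')) ?_ ?_).1 (hsplit.ge.trans h)
  · simp [ENNReal.rpow_eq_zero_iff, hI0, hI]
  · exact ENNReal.rpow_ne_top_of_nonneg (one_div_nonneg.2 htt'.symm.nonneg) hI

theorem rpow_lintegral_rpow_le_of_forall_lintegral_mul_le [IsFiniteMeasure P] {t t' : ℝ}
    (htt' : t.HolderConjugate t') {H : Ω → ℝ≥0∞} (hH : Measurable H) {C : ℝ≥0∞}
    (h : ∀ K : Ω → ℝ≥0∞, Measurable K →
      ∫⁻ ω, H ω * K ω ∂P ≤ C * (∫⁻ ω, K ω ^ t' ∂P) ^ (1 / t')) :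
    (∫⁻ ω, H ω ^ t ∂P) ^ (1 / t) ≤ C := by
  have ht1 : 0 < t - 1 := htt'.sub_one_pos
  -- The truncations have finite moments, so the self-improving bound can be divided out.
  let T (n : ℕ) (ω : Ω) : ℝ≥0∞ := min (H ω) n
  have hT (n : ℕ) : Measurable (T n) := hH.min measurable_const
  have hTfin (n : ℕ) : ∫⁻ ω, T n ω ^ t ∂P ≠ ∞ := by
    refine ne_top_of_le_ne_top ?_ (lintegral_mono (g := fun _ => (n : ℝ≥0∞) ^ t) fun ω =>
      ENNReal.rpow_le_rpow (min_le_right _ _) htt'.nonneg)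
    rw [lintegral_const]
    exact ENNReal.mul_ne_top (ENNReal.rpow_ne_top_of_nonneg htt'.nonneg (by simp))
      (measure_ne_top P _)
  have hTself (n : ℕ) : ∫⁻ ω, T n ω ^ t ∂P ≤ C * (∫⁻ ω, T n ω ^ t ∂P) ^ (1 / t') := by
    calc ∫⁻ ω, T n ω ^ t ∂P ≤ ∫⁻ ω, H ω * T n ω ^ (t - 1) ∂P := by
          refine lintegral_mono fun ω => ?_
          rw [show t = 1 + (t - 1) by ring, ENNReal.rpow_add_of_nonneg _ _ zero_le_one ht1.le,
            ENNReal.rpow_one, add_sub_cancel_left]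
          gcongr
          exact min_le_left _ _
      _ ≤ C * (∫⁻ ω, (T n ω ^ (t - 1)) ^ t' ∂P) ^ (1 / t') := h _ ((hT n).pow_const _)
      _ = C * (∫⁻ ω, T n ω ^ t ∂P) ^ (1 / t') := by
          simp only [← ENNReal.rpow_mul, htt'.sub_one_mul_conj]
  have hTtendsto (ω : Ω) : Tendsto (fun n => T n ω ^ t) atTop (𝓝 (H ω ^ t)) := by
    refine (ENNReal.continuous_rpow_const.tendsto _).comp ?_
    simpa [T] using (tendsto_const_nhds (x := H ω)).min ENNReal.tendsto_nat_nhds_top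
  refine le_of_tendsto' ((ENNReal.continuous_rpow_const.tendsto _).comp
    (lintegral_tendsto_of_tendsto_of_monotone (fun n => ((hT n).pow_const t).aemeasurable)
      (ae_of_all _ fun ω m n hmn => ?_) (ae_of_all _ hTtendsto))) fun n =>
    rpow_one_div_le_of_le_mul_rpow htt' (hTfin n) (hTself n)
  exact ENNReal.rpow_le_rpow (min_le_min_left _ (by exact_mod_cast hmn)) htt'.nonneg

theorem lintegral_lintegral_mul_le [SFinite μ] [SFinite P] {F : S → Ω → ℝ≥0∞}
    (hF : Measurable (Function.uncurry F)) {K : Ω → ℝ≥0∞} (hK : Measurable K) {t t' : ℝ}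
    (htt' : t.HolderConjugate t') :
    ∫⁻ ω, (∫⁻ s, F s ω ∂μ) * K ω ∂P
      ≤ (∫⁻ s, (∫⁻ ω, F s ω ^ t ∂P) ^ (1 / t) ∂μ) * (∫⁻ ω, K ω ^ t' ∂P) ^ (1 / t') := by
  calc ∫⁻ ω, (∫⁻ s, F s ω ∂μ) * K ω ∂P = ∫⁻ ω, ∫⁻ s, F s ω * K ω ∂μ ∂P :=
        lintegral_congr fun ω => (lintegral_mul_const _ (hF.comp measurable_prodMk_right)).symm
    _ = ∫⁻ s, ∫⁻ ω, F s ω * K ω ∂P ∂μ :=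
        lintegral_lintegral_swap
          ((hF.comp measurable_swap).mul (hK.comp measurable_fst)).aemeasurable
    _ ≤ ∫⁻ s, (∫⁻ ω, F s ω ^ t ∂P) ^ (1 / t) * (∫⁻ ω, K ω ^ t' ∂P) ^ (1 / t') ∂μ :=
        lintegral_mono fun s => ENNReal.lintegral_mul_le_Lp_mul_Lq P htt'
          (hF.comp measurable_prodMk_left).aemeasurable hK.aemeasurable
    _ = (∫⁻ s, (∫⁻ ω, F s ω ^ t ∂P) ^ (1 / t) ∂μ) * (∫⁻ ω, K ω ^ t' ∂P) ^ (1 / t') :=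
        lintegral_mul_const _ ((hF.pow_const t).lintegral_prod_right'.pow_const _)

variable [SFinite μ] [IsFiniteMeasure P]

theorem rpow_lintegral_rpow_lintegral_le {F : S → Ω → ℝ≥0∞}
    (hF : Measurable (Function.uncurry F)) {t : ℝ} (ht : 1 ≤ t) :
    (∫⁻ ω, (∫⁻ s, F s ω ∂μ) ^ t ∂P) ^ (1 / t) ≤ ∫⁻ s, (∫⁻ ω, F s ω ^ t ∂P) ^ (1 / t) ∂μ := by
  rcases ht.eq_or_lt with rfl | ht
  · simp only [ENNReal.rpow_one, div_one]
    rw [lintegral_lintegral_swap hF.aemeasurable]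
  have htt' := Real.HolderConjugate.conjExponent ht
  exact rpow_lintegral_rpow_le_of_forall_lintegral_mul_le htt' hF.lintegral_prod_left'
    fun K hK => lintegral_lintegral_mul_le hF hK htt'

theorem eLpNorm_eLpNorm_swap_le {E : Type*} [NormedAddCommGroup E] [MeasurableSpace E]
    [OpensMeasurableSpace E] {g : S → Ω → E} (hg : Measurable (Function.uncurry g)) {p q : ℝ≥0}
    (hp : p ≠ 0) (hpq : p ≤ q) :
    eLpNorm (fun ω => eLpNorm (fun s => g s ω) p μ) q P
      ≤ eLpNorm (fun s => eLpNorm (g s) q P) p μ := by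
  have hp' : (0 : ℝ) < p := by positivity
  have hq : q ≠ 0 := (hp.bot_lt.trans_le hpq).ne'
  have hmul : (p : ℝ) * (q / p) = q := mul_div_cancel₀ _ hp'.ne'
  have hleft : (eLpNorm (fun ω => eLpNorm (fun s => g s ω) p μ) q P) ^ (q : ℝ)
      = ∫⁻ ω, (∫⁻ s, ‖g s ω‖ₑ ^ (p : ℝ) ∂μ) ^ ((q : ℝ) / p) ∂P := by
    rw [eLpNorm_nnreal_pow_eq_lintegral hq]
    simp only [enorm_eq_self, ← eLpNorm_nnreal_pow_eq_lintegral hp, ← ENNReal.rpow_mul, hmul]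
  have hright : (eLpNorm (fun s => eLpNorm (g s) q P) p μ) ^ (p : ℝ)
      = ∫⁻ s, (∫⁻ ω, (‖g s ω‖ₑ ^ (p : ℝ)) ^ ((q : ℝ) / p) ∂P) ^ (1 / ((q : ℝ) / p)) ∂μ := by
    rw [eLpNorm_nnreal_pow_eq_lintegral hp]
    simp only [enorm_eq_self, ← ENNReal.rpow_mul, hmul, ← eLpNorm_nnreal_pow_eq_lintegral hq]
    rw [one_div_div, mul_div_cancel₀ _ (NNReal.coe_ne_zero.2 hq)]
  rw [← ENNReal.rpow_le_rpow_iff hp', hright]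
  calc (eLpNorm (fun ω => eLpNorm (fun s => g s ω) p μ) q P) ^ (p : ℝ)
      = (∫⁻ ω, (∫⁻ s, ‖g s ω‖ₑ ^ (p : ℝ) ∂μ) ^ ((q : ℝ) / p) ∂P) ^ (1 / ((q : ℝ) / p)) := by
        rw [← hleft, ← ENNReal.rpow_mul, one_div_div, mul_div_cancel₀ _ (NNReal.coe_ne_zero.2 hq)]
    _ ≤ ∫⁻ s, (∫⁻ ω, (‖g s ω‖ₑ ^ (p : ℝ)) ^ ((q : ℝ) / p) ∂P) ^ (1 / ((q : ℝ) / p)) ∂μ :=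
        rpow_lintegral_rpow_lintegral_le (hg.enorm.pow_const _)
          ((one_le_div hp').2 (by exact_mod_cast hpq))

end Minkowski

section MixedNormEstimates

variable {S Ω : Type*} [MeasurableSpace S] [MeasurableSpace Ω] {μ : Measure S} {P : Measure Ω}

theorem measurable_eLpNorm_prodMk_left [SFinite P] {g : S → Ω → ℝ}
    (hg : Measurable (Function.uncurry g)) {q : ℝ≥0} (hq : q ≠ 0) :
    Measurable fun s => eLpNorm (g s) q P := by
  simp only [eLpNorm_nnreal_eq_lintegral hq]
  exact (hg.enorm.pow_const (q : ℝ)).lintegral_prod_right'.pow_const _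

theorem MemLpLq.lpLqNorm_lt_top {p q : ℝ≥0∞} [Fact (1 ≤ q)] {η : Ω → Lp ℝ p μ}
    (h : MemLpLq P η q) : lpLqNorm P η q < ∞ := by
  obtain ⟨g, hg, G, hGg, hG⟩ := h
  refine (iInf₂_le g hg).trans_lt (lt_of_eq_of_lt (eLpNorm_congr_enorm_ae ?_) hG.2)
  filter_upwards [hGg] with s hs
  rw [enorm_eq_self, Lp.enorm_def, eLpNorm_congr_ae hs]

theorem lpLqNorm_mono_exponent [IsProbabilityMeasure P] {p q t : ℝ≥0∞} (hqt : q ≤ t)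
    (η : Ω → Lp ℝ p μ) : lpLqNorm P η q ≤ lpLqNorm P η t := by
  refine iInf₂_mono fun g hg => eLpNorm_mono_enorm fun s => ?_
  rw [enorm_eq_self, enorm_eq_self]
  exact eLpNorm_le_eLpNorm_of_exponent_le hqt
    (hg.1.comp measurable_prodMk_left).aestronglyMeasurable

theorem lpLqNorm_const [IsProbabilityMeasure P] [SigmaFinite μ] {p q : ℝ≥0∞} (hq : q ≠ 0)
    (f : Lp ℝ p μ) : lpLqNorm P (fun _ => f) q = ‖f‖ₑ := by
  rw [lpLqNorm_eq (isJointVersion_const f), Lp.enorm_def]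
  refine eLpNorm_congr_enorm_ae (ae_of_all _ fun s => ?_)
  rw [eLpNorm_const _ hq (IsProbabilityMeasure.ne_zero P)]
  simp

theorem lpLqNorm_sub_le [SFinite P] {p : ℝ≥0∞} [hp : Fact (1 ≤ p)] {q : ℝ≥0} (hq : 1 ≤ q)
    (η₁ η₂ : Ω → Lp ℝ p μ) :
    lpLqNorm P (η₁ - η₂) q ≤ lpLqNorm P η₁ q + lpLqNorm P η₂ q := by
  have hq0 : q ≠ 0 := (zero_lt_one.trans_le hq).ne'
  simp only [lpLqNorm, ENNReal.iInf_add, ENNReal.add_iInf]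
  refine le_iInf₂ fun g₂ h₂ => le_iInf₂ fun g₁ h₁ => (iInf₂_le _ (h₁.sub h₂)).trans ?_
  refine le_trans (eLpNorm_mono_enorm (g := (fun s => eLpNorm (g₁ s) q P) +
    fun s => eLpNorm (g₂ s) q P) fun s => ?_)
    (eLpNorm_add_le (measurable_eLpNorm_prodMk_left h₁.1 hq0).aestronglyMeasurable
      (measurable_eLpNorm_prodMk_left h₂.1 hq0).aestronglyMeasurable hp.out)
  rw [enorm_eq_self, enorm_eq_self]
  exact eLpNorm_sub_le (h₁.1.comp measurable_prodMk_left).aestronglyMeasurable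
    (h₂.1.comp measurable_prodMk_left).aestronglyMeasurable (by exact_mod_cast hq)

theorem eLpNorm_le_lpLqNorm [SFinite μ] [IsFiniteMeasure P] {p q : ℝ≥0} (hp : p ≠ 0) (hpq : p ≤ q)
    (η : Ω → Lp ℝ p μ) : eLpNorm η q P ≤ lpLqNorm P η q :=
  le_iInf₂ fun _ hg => (hg.eLpNorm_eq _).trans_le (eLpNorm_eLpNorm_swap_le hg.1 hp hpq)

theorem memLp_of_lpLqNorm_lt_top [SFinite μ] [IsFiniteMeasure P] {p q : ℝ≥0}
    [hp : Fact (1 ≤ (p : ℝ≥0∞))] (hpq : p ≤ q) {η : Ω → Lp ℝ p μ} (hη : AEStronglyMeasurable η P)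
    (h : lpLqNorm P η q < ∞) : MemLp η q P :=
  have hp0 : p ≠ 0 := by exact_mod_cast (zero_lt_one.trans_le hp.out).ne'
  ⟨hη, (eLpNorm_le_lpLqNorm hp0 hpq η).trans_lt h⟩

theorem lpLqNorm_sub_integral_lt_top [SigmaFinite μ] [IsProbabilityMeasure P] {p : ℝ≥0∞}
    [Fact (1 ≤ p)] {q : ℝ≥0} (hq : 1 ≤ q) {η : Ω → Lp ℝ p μ} (h : lpLqNorm P η q < ∞) :
    lpLqNorm P (fun ω => η ω - ∫ ω', η ω' ∂P) q < ∞ := by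
  refine (lpLqNorm_sub_le hq η fun _ => ∫ ω', η ω' ∂P).trans_lt (ENNReal.add_lt_top.2 ⟨h, ?_⟩)
  rw [lpLqNorm_const (by exact_mod_cast (zero_lt_one.trans_le hq).ne')]
  exact enorm_lt_top

end MixedNormEstimates

section MonteCarlo

variable {S Ω : Type*} [MeasurableSpace S] [MeasurableSpace Ω] {μ : Measure S} {P : Measure Ω}

theorem exists_isJointVersion_iIndepFun_identDistrib {p : ℝ≥0∞} [Fact (1 ≤ p)]
    [MeasurableSpace (Lp ℝ p μ)] [BorelSpace (Lp ℝ p μ)] {ι : Type*} {Z : ι → Ω → Lp ℝ p μ}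
    {Y : Ω → Lp ℝ p μ} (hindep : iIndepFun Z P) (hZ : ∀ j, IdentDistrib (Z j) Y P P)
    (hY : AEStronglyMeasurable Y P) :
    ∃ (z : ι → S → Ω → ℝ) (y : S → Ω → ℝ), (∀ j, IsJointVersion P (Z j) (z j)) ∧
      IsJointVersion P Y y ∧ ∀ s, iIndepFun (fun j => z j s) P ∧
        ∀ j, IdentDistrib (z j s) (y s) P P := by
  have hYm : AEMeasurable Y P := hY.aemeasurable
  have hZm (j : ι) : AEMeasurable (Z j) P := (hZ j).aemeasurable_fst
  have hYid : IdentDistrib Y id P (P.map Y) := ⟨hYm, aemeasurable_id, Measure.map_id.symm⟩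
  -- Using one and the same version of the identity for all variables transports independence and
  -- equality in distribution to every slice.
  obtain ⟨e, he⟩ := exists_isJointVersion (hYid.aestronglyMeasurable_snd hY)
  have hes (s : S) : Measurable (e s) := he.1.comp measurable_prodMk_left
  have hident (j : ι) : IdentDistrib ((hZm j).mk (Z j)) (hYm.mk Y) P P :=
    (IdentDistrib.of_ae_eq (hZm j) (hZm j).ae_eq_mk).symm.trans
      ((hZ j).trans (IdentDistrib.of_ae_eq hYm hYm.ae_eq_mk))
  exact ⟨fun j s ω => e s ((hZm j).mk (Z j) ω), fun s ω => e s (hYm.mk Y ω),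
    fun j => he.comp_of_map_eq (hZm j).measurable_mk (hZm j).ae_eq_mk (hZ j).map_eq,
    he.comp_of_map_eq hYm.measurable_mk hYm.ae_eq_mk rfl,
    fun s => ⟨(hindep.congr fun j => (hZm j).ae_eq_mk).comp _ fun _ => hes s,
      fun j => (hident j).comp (hes s)⟩⟩

variable [SigmaFinite μ] [IsProbabilityMeasure P] {p q r : ℝ≥0} [hp : Fact (1 ≤ (p : ℝ≥0∞))]
  [MeasurableSpace (Lp ℝ p μ)] [BorelSpace (Lp ℝ p μ)] {M : ℕ} {Z : Fin M → Ω → Lp ℝ p μ}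
  {Y : Ω → Lp ℝ p μ}

theorem eLpNorm_sum_le_khintchineB_mul_lpLqNorm (hpq : p ≤ q) (hr : 0 < r) (hr2 : r ≤ 2)
    (hindep : iIndepFun Z P) (hZ : ∀ j, IdentDistrib (Z j) Y P P) (hY : Integrable Y P)
    (hmean : ∫ ω, Y ω ∂P = 0) :
    eLpNorm (fun ω => ∑ j, Z j ω) q P
      ≤ 2 * khintchineB q * (M ^ (1 / (r : ℝ)) * lpLqNorm P Y (max q r : ℝ≥0)) := by
  have hp1 : 1 ≤ p := by exact_mod_cast hp.out
  obtain ⟨z, y, hz, hy, hiid⟩ := exists_isJointVersion_iIndepFun_identDistrib hindep hZ hY.1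
  have hsum := IsJointVersion.fun_sum Finset.univ fun j _ => hz j
  have hymean : ∀ᵐ s ∂μ, ∫ ω, y s ω ∂P = 0 := by
    filter_upwards [hy.integral_ae_eq_coeFn_integral hY, Lp.coeFn_zero ℝ p μ] with s hs hs0
    rw [hs, hmean, hs0, Pi.zero_apply]
  have hCfin : 2 * (khintchineB q : ℝ≥0∞) * M ^ (1 / (r : ℝ)) ≠ ∞ :=
    ENNReal.mul_ne_top (by finiteness) (ENNReal.rpow_ne_top_of_nonneg (by positivity) (by simp))
  obtain ⟨C, hC⟩ : ∃ C : ℝ≥0, (C : ℝ≥0∞) = 2 * khintchineB q * M ^ (1 / (r : ℝ)) :=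
    ⟨_, ENNReal.coe_toNNReal hCfin⟩
  calc eLpNorm (fun ω => ∑ j, Z j ω) q P ≤ lpLqNorm P (fun ω => ∑ j, Z j ω) q :=
        eLpNorm_le_lpLqNorm (zero_lt_one.trans_le hp1).ne' hpq _
    _ = eLpNorm (fun s => eLpNorm (fun ω => ∑ j, z j s ω) q P) p μ := lpLqNorm_eq hsum q
    _ ≤ C • eLpNorm (fun s => eLpNorm (y s) (max q r : ℝ≥0) P) p μ := by
        refine eLpNorm_le_nnreal_smul_eLpNorm_of_ae_le_mul' ?_ _
        filter_upwards [hy.ae_integrable hY, hymean] with s hsint hmean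
        rw [enorm_eq_self, enorm_eq_self, hC, mul_assoc]
        exact eLpNorm_sum_le_khintchineB_mul_of_identDistrib
          (fun j => (hz j).1.comp measurable_prodMk_left) (hiid s).1 (hiid s).2 hsint hmean
          (hp1.trans hpq) hr hr2
    _ = 2 * khintchineB q * (M ^ (1 / (r : ℝ)) * lpLqNorm P Y (max q r : ℝ≥0)) := by
        rw [lpLqNorm_eq hy, ENNReal.smul_def, smul_eq_mul, hC, mul_assoc]

theorem eLpNorm_average_sub_integral_le (hpq : p ≤ q) (hr : 0 < r) (hr2 : r ≤ 2) (hM : M ≠ 0)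
    (hindep : iIndepFun Z P) (hZ : ∀ j, IdentDistrib (Z j) Y P P) (hY : Integrable Y P) :
    eLpNorm (fun ω => (M : ℝ)⁻¹ • ∑ j, Z j ω - ∫ ω', Y ω' ∂P) q P
      ≤ 2 * khintchineB q * (M ^ (-(1 - 1 / (r : ℝ))) *
        lpLqNorm P (fun ω => Y ω - ∫ ω', Y ω' ∂P) (max q r : ℝ≥0)) := by
  set m : Lp ℝ p μ := ∫ ω', Y ω' ∂P with hm
  have hsub : Measurable fun x : Lp ℝ p μ => x - m :=
    (continuous_id.sub continuous_const).measurable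
  have hcentred : (fun ω => (M : ℝ)⁻¹ • ∑ j, Z j ω - m)
      = (M : ℝ)⁻¹ • fun ω => ∑ j, (Z j ω - m) := by
    ext1 ω
    rw [Pi.smul_apply, Finset.sum_sub_distrib, smul_sub, Finset.sum_const, Finset.card_univ,
      Fintype.card_fin, ← Nat.cast_smul_eq_nsmul ℝ, inv_smul_smul₀ (Nat.cast_ne_zero.2 hM)]
  have hmean : ∫ ω, (Y ω - m) ∂P = 0 := by
    rw [integral_sub hY (integrable_const _), integral_const, probReal_univ, one_smul, hm, sub_self]
  have hinv : ‖(M : ℝ)⁻¹‖ₑ = (M : ℝ≥0∞) ^ (-1 : ℝ) := by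
    rw [enorm_inv (Nat.cast_ne_zero.2 hM), ENNReal.rpow_neg_one]
    simp
  have hexp : -(1 - 1 / (r : ℝ)) = -1 + 1 / (r : ℝ) := by ring
  rw [hcentred, eLpNorm_const_smul, hinv, hexp,
    ENNReal.rpow_add _ _ (Nat.cast_ne_zero.2 hM) (ENNReal.natCast_ne_top M)]
  calc (M : ℝ≥0∞) ^ (-1 : ℝ) * eLpNorm (fun ω => ∑ j, (Z j ω - m)) q P
      ≤ (M : ℝ≥0∞) ^ (-1 : ℝ) * (2 * khintchineB q *
          (M ^ (1 / (r : ℝ)) * lpLqNorm P (fun ω => Y ω - m) (max q r : ℝ≥0))) := by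
        gcongr
        exact eLpNorm_sum_le_khintchineB_mul_lpLqNorm hpq hr hr2
          (hindep.comp (fun _ x => x - m) fun _ => hsub) (fun j => (hZ j).comp hsub)
          (hY.sub (integrable_const _)) hmean
    _ = _ := by ring

end MonteCarlo

section Multilevel

variable {S : Type*} {Ω : Type*} [MeasurableSpace S] [MeasurableSpace Ω] {P : Measure Ω}

theorem sum_integral_sub_pred {E : Type*} [NormedAddCommGroup E] [NormedSpace ℝ E] {L : ℕ}
    {X : ℕ → Ω → E} (hX : ∀ l ≤ L, Integrable (X l) P) :
    ∑ l ∈ Finset.Icc 1 L, ∫ ω, (X l - X (l - 1)) ω ∂P = ∫ ω, X L ω ∂P - ∫ ω, X 0 ω ∂P := by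
  induction L with
  | zero => simp
  | succ L ih =>
    rw [Finset.sum_Icc_succ_top (by lia), ih fun l hl => hX l (by lia), Nat.add_sub_cancel,
      integral_sub' (hX _ le_rfl) (hX L L.le_succ)]
    abel

theorem eLpNorm_sub_sum_le [IsProbabilityMeasure P] {E ι : Type*} [NormedAddCommGroup E]
    (t : Finset ι) {A : ι → Ω → E} (hA : ∀ i ∈ t, AEStronglyMeasurable (A i) P) (u : E) (m : ι → E)
    {q : ℝ≥0∞} (hq : 1 ≤ q) :
    eLpNorm (fun ω => u - ∑ i ∈ t, A i ω) q P
      ≤ ‖u - ∑ i ∈ t, m i‖ₑ + ∑ i ∈ t, eLpNorm (fun ω => A i ω - m i) q P := by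
  have hAm (i : ι) (hi : i ∈ t) : AEStronglyMeasurable (fun ω => A i ω - m i) P :=
    (hA i hi).sub aestronglyMeasurable_const
  have hdecomp : (fun ω => u - ∑ i ∈ t, A i ω)
      = (fun _ => u - ∑ i ∈ t, m i) - ∑ i ∈ t, fun ω => A i ω - m i := by
    ext1 ω
    simp only [Pi.sub_apply, Finset.sum_apply, Finset.sum_sub_distrib, sub_sub_sub_cancel_right]
  calc eLpNorm (fun ω => u - ∑ i ∈ t, A i ω) q P
      ≤ eLpNorm (fun _ => u - ∑ i ∈ t, m i) q P
          + eLpNorm (∑ i ∈ t, fun ω => A i ω - m i) q P := by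
        rw [hdecomp]
        exact eLpNorm_sub_le aestronglyMeasurable_const (Finset.aestronglyMeasurable_sum _ hAm) hq
    _ ≤ ‖u - ∑ i ∈ t, m i‖ₑ + ∑ i ∈ t, eLpNorm (fun ω => A i ω - m i) q P := by
        gcongr
        · simp [eLpNorm_const _ (zero_lt_one.trans_le hq).ne' (IsProbabilityMeasure.ne_zero P)]
        · exact eLpNorm_sum_le hAm hq

variable {μ : Measure S} [SigmaFinite μ] [IsProbabilityMeasure P]

theorem eLpNorm_sub_sum_average_le {p q r : ℝ≥0} [hp : Fact (1 ≤ (p : ℝ≥0∞))] (hpq : p ≤ q)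
    (hr : r ∈ Set.Ioc 0 2) [MeasurableSpace (Lp ℝ p μ)] [BorelSpace (Lp ℝ p μ)] {ι : Type*}
    (t : Finset ι) {M : ι → ℕ} (hM : ∀ i ∈ t, M i ≠ 0) {Z : (i : ι) → Fin (M i) → Ω → Lp ℝ p μ}
    {Y : ι → Ω → Lp ℝ p μ} (hindep : ∀ i ∈ t, iIndepFun (Z i) P)
    (hZ : ∀ i ∈ t, ∀ j, IdentDistrib (Z i j) (Y i) P P) (hY : ∀ i ∈ t, Integrable (Y i) P)
    (u : Lp ℝ p μ) :
    eLpNorm (fun ω => u - ∑ i ∈ t, (M i : ℝ)⁻¹ • ∑ j, Z i j ω) q P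
      ≤ ‖u - ∑ i ∈ t, ∫ ω, Y i ω ∂P‖ₑ + 2 * khintchineB q * ∑ i ∈ t,
          M i ^ (-(1 - 1 / (r : ℝ))) *
            lpLqNorm P (fun ω => Y i ω - ∫ ω', Y i ω' ∂P) (max q r : ℝ≥0) := by
  have hq : (1 : ℝ≥0∞) ≤ q := hp.out.trans (by exact_mod_cast hpq)
  have haverage (i : ι) (hi : i ∈ t) :
      AEStronglyMeasurable (fun ω => (M i : ℝ)⁻¹ • ∑ j, Z i j ω) P :=
    AEStronglyMeasurable.fun_const_smul (Finset.aestronglyMeasurable_fun_sum _ fun j _ =>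
      (hZ i hi j).symm.aestronglyMeasurable_snd (hY i hi).1) _
  refine (eLpNorm_sub_sum_le t haverage u (fun i => ∫ ω, Y i ω ∂P) hq).trans ?_
  rw [Finset.mul_sum]
  gcongr with i hi
  exact eLpNorm_average_sub_integral_le hpq hr.1 hr.2 (hM i hi) (hindep i hi) (hZ i hi) (hY i hi)

end Multilevel

theorem mainTheorem8_general {S Ω : Type*} [MeasurableSpace S] [MeasurableSpace Ω]
    (μ : Measure S) [SigmaFinite μ] (P : Measure Ω) [IsProbabilityMeasure P] (p q r : ℝ≥0)
    [hp : Fact (1 ≤ (p : ℝ≥0∞))] (hpq : p ≤ q) (hr : r ∈ Set.Ioc 0 2)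
    [MeasurableSpace (Lp ℝ p μ)] [BorelSpace (Lp ℝ p μ)]
    (L : ℕ) (X : ℕ → Ω → Lp ℝ p μ) (hX0 : X 0 = 0)
    (hX : ∀ l ∈ Finset.Icc 1 L,
      AEStronglyMeasurable (X l) P ∧ lpLqNorm P (X l) (max q r : ℝ≥0) < ∞)
    (M : ℕ → ℕ) (hM : ∀ l ∈ Finset.Icc 1 L, 1 ≤ M l)
    (ξ : (l : ℕ) → Fin (M l) → Ω → Lp ℝ p μ)
    (hξ_indep : ∀ l ∈ Finset.Icc 1 L, iIndepFun (ξ l) P)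
    (hξ_copy : ∀ l ∈ Finset.Icc 1 L, ∀ j, IdentDistrib (ξ l j) (X l - X (l - 1)) P P)
    (U : Lp ℝ p μ) :
    MemLp (fun ω => U - ∑ l ∈ Finset.Icc 1 L, (M l : ℝ)⁻¹ • ∑ j, ξ l j ω) q P ∧
    (∀ l ∈ Finset.Icc 1 L,
      lpLqNorm P (fun ω => (X l - X (l - 1)) ω - ∫ ω', (X l - X (l - 1)) ω' ∂P)
        (max q r : ℝ≥0) < ∞) ∧
    eLpNorm (fun ω => U - ∑ l ∈ Finset.Icc 1 L, (M l : ℝ)⁻¹ • ∑ j, ξ l j ω) q P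
      ≤ ‖U - ∫ ω, X L ω ∂P‖ₑ
        + 2 * (khintchineB q : ℝ≥0∞) * ∑ l ∈ Finset.Icc 1 L,
            (M l : ℝ≥0∞) ^ (-(1 - 1 / (r : ℝ))) *
              lpLqNorm P (fun ω => (X l - X (l - 1)) ω - ∫ ω', (X l - X (l - 1)) ω' ∂P)
                (max q r : ℝ≥0) := by
  have hq : 1 ≤ q := le_trans (by exact_mod_cast hp.out) hpq
  have hqr : 1 ≤ max q r := hq.trans (le_max_left _ _)
  have hXfin (l : ℕ) (hl : l ≤ L) : lpLqNorm P (X l) (max q r : ℝ≥0) < ∞ := by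
    rcases l.eq_zero_or_pos with rfl | h
    · rw [hX0]
      exact (lpLqNorm_const (by exact_mod_cast (zero_lt_one.trans_le hqr).ne') 0).trans_lt
        enorm_lt_top
    · exact (hX l (Finset.mem_Icc.2 ⟨h, hl⟩)).2
  have hXmem (l : ℕ) (hl : l ≤ L) : MemLp (X l) q P := by
    refine memLp_of_lpLqNorm_lt_top hpq ?_ ((lpLqNorm_mono_exponent (by
      exact_mod_cast le_max_left q r) _).trans_lt (hXfin l hl))
    rcases l.eq_zero_or_pos with rfl | h
    · rw [hX0]
      exact aestronglyMeasurable_zero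
    · exact (hX l (Finset.mem_Icc.2 ⟨h, hl⟩)).1
  have hle {l : ℕ} (hl : l ∈ Finset.Icc 1 L) : l ≤ L ∧ l - 1 ≤ L := by grind
  have hdiff (l : ℕ) (hl : l ∈ Finset.Icc 1 L) : MemLp (X l - X (l - 1)) q P :=
    (hXmem l (hle hl).1).sub (hXmem _ (hle hl).2)
  have hq' : (1 : ℝ≥0∞) ≤ q := by exact_mod_cast hq
  refine ⟨?_, fun l hl => ?_, ?_⟩
  · exact (memLp_const U).sub (memLp_finsetSum _ fun l hl => (memLp_finsetSum _ fun j _ =>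
      (hξ_copy l hl j).memLp_iff.2 (hdiff l hl)).const_smul (M l : ℝ)⁻¹)
  · exact lpLqNorm_sub_integral_lt_top hqr ((lpLqNorm_sub_le hqr _ _).trans_lt
      (ENNReal.add_lt_top.2 ⟨hXfin l (hle hl).1, hXfin _ (hle hl).2⟩))
  · have htel := sum_integral_sub_pred fun l hl => (hXmem l hl).integrable hq'
    rw [hX0, integral_zero', sub_zero] at htel
    rw [← htel]
    exact eLpNorm_sub_sum_average_le hpq hr _ (fun l hl => Nat.one_le_iff_ne_zero.1 (hM l hl))
      hξ_indep hξ_copy (fun l hl => (hdiff l hl).integrable hq') U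

theorem mainTheorem8 {S : Type u} {Ω : Type v} [MeasurableSpace S] [MeasurableSpace Ω]
    (μ : Measure S) [SigmaFinite μ] (P : Measure Ω) [IsProbabilityMeasure P]
    (hS : ApproximationByAveraging.{u, v} μ)
    (p q qt : ℝ≥0) [Fact (1 ≤ (p : ℝ≥0∞))] [Fact (1 ≤ (qt : ℝ≥0∞))] (hpq : p ≤ q) (hqt : q ≤ qt)
    -- `L^p(S)` carries its Borel σ-algebra
    [MeasurableSpace (Lp ℝ p μ)] [BorelSpace (Lp ℝ p μ)]
    (L : ℕ) (hL : 1 ≤ L)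
    (X : ℕ → Ω → Lp ℝ p μ) (hX0 : X 0 = 0)
    (hX : ∀ l ∈ Finset.Icc 1 L, MemLp (X l) qt P ∧ MemLpLq P (X l) qt)
    (M : ℕ → ℕ) (hM : ∀ l ∈ Finset.Icc 1 L, 1 ≤ M l)
    -- `ξ l j`, `j < M l`, are independent copies of `X l - X (l - 1)`
    (ξ : (l : ℕ) → Fin (M l) → Ω → Lp ℝ p μ)
    (hξ_indep : ∀ l ∈ Finset.Icc 1 L, iIndepFun (ξ l) P)
    (hξ_copy : ∀ l ∈ Finset.Icc 1 L, ∀ j, IdentDistrib (ξ l j) (X l - X (l - 1)) P P)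
    (U : Lp ℝ p μ) (r : ℝ≥0) (hr : r ∈ Set.Icc (min q 2) (min qt 2)) :
    MemLp (fun ω => U - ∑ l ∈ Finset.Icc 1 L, (M l : ℝ)⁻¹ • ∑ j, ξ l j ω) q P ∧
    (∀ l ∈ Finset.Icc 1 L,
      lpLqNorm P (fun ω => (X l - X (l - 1)) ω - ∫ ω', (X l - X (l - 1)) ω' ∂P)
        (max q r : ℝ≥0) < ∞) ∧
    eLpNorm (fun ω => U - ∑ l ∈ Finset.Icc 1 L, (M l : ℝ)⁻¹ • ∑ j, ξ l j ω) q P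
      ≤ ‖U - ∫ ω, X L ω ∂P‖ₑ
        + 2 * (khintchineB q : ℝ≥0∞) * ∑ l ∈ Finset.Icc 1 L,
            (M l : ℝ≥0∞) ^ (-(1 - 1 / (r : ℝ))) *
              lpLqNorm P (fun ω => (X l - X (l - 1)) ω - ∫ ω', (X l - X (l - 1)) ω' ∂P)
                (max q r : ℝ≥0) := by
  have hp : 1 ≤ p := by exact_mod_cast (Fact.out : 1 ≤ (p : ℝ≥0∞))
  have hr0 : 0 < r := (lt_min (zero_lt_one.trans_le (hp.trans hpq)) two_pos).trans_le hr.1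
  exact mainTheorem8_general μ P p q r hpq ⟨hr0, hr.2.trans (min_le_right _ _)⟩ L X hX0
    (fun l hl => ⟨(hX l hl).1.1, (lpLqNorm_mono_exponent
      (by exact_mod_cast max_le hqt (hr.2.trans (min_le_left _ _))) _).trans_lt
      (hX l hl).2.lpLqNorm_lt_top⟩)
    M hM ξ hξ_indep hξ_copy U
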